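/- Let $\mathbb{K}\in\{\mathbb{R},\mathbb{C}\}$ be the field of scalars. **Notation.** $H^1(\mathbb{R})$ is the real Hardy space of all $f\in L^1(\mathbb{R})$ whose Hilbert transform $Hf(x)=\frac1\pi\,\mathrm{p.v.}\!\int_{\mathbb{R}}\frac{f(y)}{x-y}\,dy$ (the Fourier multiplier $-i\,\mathrm{sgn}\,\xi$) belongs to $L^1(\mathbb{R})$, with the norm $\|f\|_{H^1}=\|f\|_{L^1}+\|Hf\|_{L^1}$. $E\hat\otimes_\pi G$ is the completion of the algebraic tensor product $E\otimes G$ in the projective norm $\inf\{\sum_i\|x_i\|\|y_i\| : u=\sum_i x_i\otimes y_i\}$. For a function $f$ on $\mathbb{R}^2$ put $$(\mathbf{K}f)(x_1,x_2)=\frac1\pi\int_{\mathbb{R}}\left(\mathrm{p.v.}\!\int_{\mathbb{R}}\frac{f(y_1,y_2)}{x_1y_2-x_2y_1}\,dy_1\right)dy_2$$ whenever the inner principal values exist for almost every $y_2$ and the outer integral exists. A Banach lattice of measurable functions on $\mathbb{R}^2$, with respect to a non-negative Borel measure $\mu$ on $\mathbb{R}^2$, is a linear space $F$ of ($\mu$-a.e.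 classes of) $\mathbb{K}$-valued measurable functions with a complete norm such that, whenever $g\in F$, $f$ is measurable and $|f|\le|g|$ $\mu$-a.e., one has $f\in F$ and $\|f\|_F\le\|g\|_F$. **Statement.** Let $\mu$ be a non-negative Borel measure on $\mathbb{R}^2$ with $\mu(\{x_1=0\})=0$ (for example Lebesgue measure), so that $w_1(x_1,x_2)=|x_1|^{-1}$ is defined $\mu$-a.e., and let $F$ be a Banach lattice of measurable functions on $\mathbb{R}^2$ with respect to $\mu$. If $w_1\in F$, then $\mathbf{K}$ is bounded as an operator from $H^1(\mathbb{R})\hat\otimes_\pi L^\infty(\mathbb{R})$ to $F$ and $$\|\mathbf{K}\|_{H^1(\mathbb{R})\hat\otimes_\pi L^\infty(\mathbb{R})\to F}\le\|w_1\|_F .$$ That is, there is a bounded linear operator $H^1(\mathbb{R})\hat\otimes_\pi L^\infty(\mathbb{R})\to F$ of norm at most $\|w_1\|_F$ which on every element $\sum_{i=1}^n f_i\otimes g_i$ of the algebraic tensor product $H^1(\mathbb{R})\otimes L^\infty(\mathbb{R})$ is given by the integral: for $\mu$-a.e. $x\in\mathbb{R}^2$ the value $(\mathbf{K}f)(x)$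 with $f(y_1,y_2)=\sum_i f_i(y_1)g_i(y_2)$ exists, the outer integral converging absolutely, and equals the value at $x$ of the image. -/

import Mathlib

open MeasureTheory Filter Topology Set
open scoped ENNReal TensorProduct FourierTransform

noncomputable section

/-! ### Banach lattices of measurable functions -/

/-- A Banach lattice of (`μ`-a.e. classes of) measurable `𝕜`-valued functions: a linear subspace
of `L⁰(μ)` which is solid (an order ideal), with a complete monotone norm. -/
structure BanachFunctionLattice (𝕜 : Type*) [RCLike 𝕜] {α : Type*} [MeasurableSpace α]
    (μ : Measure α) where
  carrier : Submodule 𝕜 (α →ₘ[μ] 𝕜)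
  normFn : carrier → ℝ
  normFn_nonneg : ∀ f, 0 ≤ normFn f
  normFn_smul : ∀ (c : 𝕜) (f : carrier), normFn (c • f) = ‖c‖ * normFn f
  normFn_add_le : ∀ f g : carrier, normFn (f + g) ≤ normFn f + normFn g
  eq_zero_of_normFn : ∀ f : carrier, normFn f = 0 → f = 0
  solid : ∀ (f : α →ₘ[μ] 𝕜) (g : carrier),
    (∀ᵐ x ∂μ, ‖f x‖ ≤ ‖(g : α →ₘ[μ] 𝕜) x‖) →
      ∃ hf : f ∈ carrier, normFn ⟨f, hf⟩ ≤ normFn g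
  complete : ∀ u : ℕ → carrier,
    (∀ ε > 0, ∃ N, ∀ m ≥ N, ∀ n ≥ N, normFn (u m - u n) < ε) →
      ∃ l : carrier, Tendsto (fun n => normFn (u n - l)) atTop (𝓝 0)

namespace BanachFunctionLattice

variable {𝕜 : Type*} [RCLike 𝕜] {α : Type*} [MeasurableSpace α] {μ : Measure α}

instance instNorm (F : BanachFunctionLattice 𝕜 μ) : Norm F.carrier := ⟨F.normFn⟩

theorem core (F : BanachFunctionLattice 𝕜 μ) : NormedSpace.Core 𝕜 F.carrier where
  norm_nonneg := F.normFn_nonneg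
  norm_smul := F.normFn_smul
  norm_triangle := F.normFn_add_le
  norm_eq_zero_iff f := by
    refine ⟨F.eq_zero_of_normFn f, ?_⟩
    rintro rfl
    have h := F.normFn_smul 0 0
    rw [norm_zero, zero_mul, zero_smul] at h
    exact h

instance instNormedAddCommGroup (F : BanachFunctionLattice 𝕜 μ) :
    NormedAddCommGroup F.carrier := NormedAddCommGroup.ofCore F.core

instance instNormedSpace (F : BanachFunctionLattice 𝕜 μ) : NormedSpace 𝕜 F.carrier :=
  NormedSpace.ofCore F.core

instance instCompleteSpace (F : BanachFunctionLattice 𝕜 μ) : CompleteSpace F.carrier := by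
  refine Metric.complete_of_cauchySeq_tendsto fun u hu => ?_
  obtain ⟨l, hl⟩ := F.complete u fun ε hε => by
    obtain ⟨N, hN⟩ := Metric.cauchySeq_iff.1 hu ε hε
    exact ⟨N, fun m hm n hn => (dist_eq_norm (u m) (u n)).symm.trans_lt (hN m hm n hn)⟩
  exact ⟨l, tendsto_iff_norm_sub_tendsto_zero.2 hl⟩

end BanachFunctionLattice

/-! ### Projective tensor products -/

/-- The algebraic tensor product, to be equipped with the projective norm. -/
def ProjTensor (𝕜 E G : Type*) [RCLike 𝕜] [NormedAddCommGroup E] [NormedSpace 𝕜 E]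
    [NormedAddCommGroup G] [NormedSpace 𝕜 G] : Type _ := E ⊗[𝕜] G

namespace ProjTensor

variable {𝕜 E G : Type*} [RCLike 𝕜] [NormedAddCommGroup E] [NormedSpace 𝕜 E]
    [NormedAddCommGroup G] [NormedSpace 𝕜 G]

instance instAddCommGroup : AddCommGroup (ProjTensor 𝕜 E G) :=
  inferInstanceAs (AddCommGroup (E ⊗[𝕜] G))

instance instModule : Module 𝕜 (ProjTensor 𝕜 E G) := inferInstanceAs (Module 𝕜 (E ⊗[𝕜] G))

/-- The elementary tensor `x ⊗ y`. -/
def tmul (x : E) (y : G) : ProjTensor 𝕜 E G := x ⊗ₜ[𝕜] y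

/-- The numbers `∑ ‖xᵢ‖ ‖yᵢ‖` over all finite representations `u = ∑ xᵢ ⊗ yᵢ`. -/
def reprSums (u : ProjTensor 𝕜 E G) : Set ℝ :=
  {r | ∃ (n : ℕ) (x : Fin n → E) (y : Fin n → G),
    u = ∑ i, tmul (x i) (y i) ∧ r = ∑ i, ‖x i‖ * ‖y i‖}

/-- The projective norm `π(u) = inf {∑ ‖xᵢ‖ ‖yᵢ‖ : u = ∑ xᵢ ⊗ yᵢ}`. -/
instance instNorm : Norm (ProjTensor 𝕜 E G) := ⟨fun u => sInf (reprSums u)⟩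

theorem reprSums_nonempty (u : ProjTensor 𝕜 E G) : (reprSums u).Nonempty := by
  refine TensorProduct.induction_on (motive := fun u : E ⊗[𝕜] G =>
    (reprSums (𝕜 := 𝕜) (E := E) (G := G) u).Nonempty) u ?_ ?_ ?_
  · exact ⟨0, 0, Fin.elim0, Fin.elim0, by simp; rfl, by simp⟩
  · exact fun x y => ⟨_, 1, fun _ => x, fun _ => y, by simp; rfl, rfl⟩
  · rintro u v ⟨_, n, x, y, hu, -⟩ ⟨_, m, x', y', hv, -⟩
    refine ⟨_, n + m, Fin.append x x', Fin.append y y', ?_, rfl⟩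
    rw [Fin.sum_univ_add]
    simp only [Fin.append_left, Fin.append_right]
    rw [← hu, ← hv]
    rfl

theorem reprSums_bddBelow (u : ProjTensor 𝕜 E G) : BddBelow (reprSums u) :=
  ⟨0, by rintro _ ⟨n, x, y, -, rfl⟩; positivity⟩

theorem norm_add_le' (u v : ProjTensor 𝕜 E G) : ‖u + v‖ ≤ ‖u‖ + ‖v‖ := by
  refine le_of_forall_pos_le_add fun ε hε => ?_
  obtain ⟨_, ⟨n, x, y, hu, rfl⟩, h1⟩ :=
    exists_lt_of_csInf_lt (reprSums_nonempty u) (lt_add_of_pos_right (sInf (reprSums u)) (half_pos hε))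
  obtain ⟨_, ⟨m, x', y', hv, rfl⟩, h2⟩ :=
    exists_lt_of_csInf_lt (reprSums_nonempty v) (lt_add_of_pos_right (sInf (reprSums v)) (half_pos hε))
  have h3 : sInf (reprSums (u + v)) ≤ ∑ i, ‖x i‖ * ‖y i‖ + ∑ i, ‖x' i‖ * ‖y' i‖ := by
    refine csInf_le (reprSums_bddBelow _) ⟨n + m, Fin.append x x', Fin.append y y', ?_, ?_⟩
    · rw [Fin.sum_univ_add]
      simp only [Fin.append_left, Fin.append_right]
      rw [← hu, ← hv]
    · rw [Fin.sum_univ_add]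
      simp only [Fin.append_left, Fin.append_right]
  change sInf (reprSums (u + v)) ≤ sInf (reprSums u) + sInf (reprSums v) + ε
  linarith

theorem norm_smul_le' (c : 𝕜) (u : ProjTensor 𝕜 E G) : ‖c • u‖ ≤ ‖c‖ * ‖u‖ := by
  refine le_of_forall_pos_le_add fun ε hε => ?_
  have hc : 0 < ‖c‖ + 1 := by positivity
  obtain ⟨_, ⟨n, x, y, hu, rfl⟩, h1⟩ :=
    exists_lt_of_csInf_lt (reprSums_nonempty u)
      (lt_add_of_pos_right (sInf (reprSums u)) (div_pos hε hc))
  have h3 : sInf (reprSums (c • u)) ≤ ‖c‖ * ∑ i, ‖x i‖ * ‖y i‖ := by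
    refine csInf_le (reprSums_bddBelow _) ⟨n, fun i => c • x i, y, ?_, ?_⟩
    · rw [hu, Finset.smul_sum]
      rfl
    · simp [Finset.mul_sum, norm_smul, mul_assoc]
  have h4 : ‖c‖ * (ε / (‖c‖ + 1)) ≤ ε := by
    rw [mul_div_assoc', div_le_iff₀ hc]
    nlinarith
  have h5 := mul_le_mul_of_nonneg_left h1.le (norm_nonneg c)
  change sInf (reprSums (c • u)) ≤ ‖c‖ * sInf (reprSums u) + ε
  linarith [mul_add ‖c‖ (sInf (reprSums u)) (ε / (‖c‖ + 1))]

theorem norm_zero' : ‖(0 : ProjTensor 𝕜 E G)‖ = 0 := by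
  refine le_antisymm ?_ ?_
  · simpa using norm_smul_le' (0 : 𝕜) (0 : ProjTensor 𝕜 E G)
  · exact Real.sInf_nonneg (by rintro _ ⟨n, x, y, -, rfl⟩; positivity)

/-- The projective norm as a seminorm. -/
def projSeminorm : Seminorm 𝕜 (ProjTensor 𝕜 E G) :=
  Seminorm.ofSMulLE norm norm_zero' norm_add_le' norm_smul_le'

instance instSeminormedAddCommGroup : SeminormedAddCommGroup (ProjTensor 𝕜 E G) :=
  AddGroupSeminorm.toSeminormedAddCommGroup
    (projSeminorm : Seminorm 𝕜 (ProjTensor 𝕜 E G)).toAddGroupSeminorm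

instance instNormedSpace : NormedSpace 𝕜 (ProjTensor 𝕜 E G) := ⟨norm_smul_le'⟩

end ProjTensor

/-- The completed projective tensor product `E ⊗̂_π G`. -/
abbrev CompletedProjTensor (𝕜 E G : Type*) [RCLike 𝕜] [NormedAddCommGroup E] [NormedSpace 𝕜 E]
    [NormedAddCommGroup G] [NormedSpace 𝕜 G] : Type _ :=
  UniformSpace.Completion (ProjTensor 𝕜 E G)

/-! ### The real Hardy space `H¹(ℝ)` -/

/-- `h` is the Hilbert transform of `f` (both in `L¹(ℝ)`), where the Hilbert transform is
convolution with `p.v. 1/(π t)`, i.e. the Fourier multiplier `-i sgn ξ`. The map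
`RCLike.map 𝕜 ℂ` is the inclusion of the scalar field `𝕜` (`ℝ` or `ℂ`) into `ℂ`. -/
def IsHilbertTransform {𝕜 : Type*} [RCLike 𝕜] (f h : ℝ → 𝕜) : Prop :=
  ∀ ξ : ℝ, 𝓕 (fun t => RCLike.map 𝕜 ℂ (h t)) ξ =
    -Complex.I * (SignType.sign ξ : ℂ) * 𝓕 (fun t => RCLike.map 𝕜 ℂ (f t)) ξ

theorem map_mul_toComplex {𝕜 : Type*} [RCLike 𝕜] (a b : 𝕜) :
    RCLike.map 𝕜 ℂ (a * b) = RCLike.map 𝕜 ℂ a * RCLike.map 𝕜 ℂ b := by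
  apply Complex.ext <;> simp [RCLike.map]

theorem integrable_toComplex {𝕜 : Type*} [RCLike 𝕜] (f : Lp 𝕜 1 (volume : Measure ℝ)) :
    Integrable (fun t => RCLike.map 𝕜 ℂ (f t)) :=
  (RCLike.map 𝕜 ℂ).integrable_comp (L1.integrable_coeFn f)

theorem fourier_toComplex_add {𝕜 : Type*} [RCLike 𝕜] (f g : Lp 𝕜 1 (volume : Measure ℝ)) (ξ : ℝ) :
    𝓕 (fun t => RCLike.map 𝕜 ℂ ((f + g) t)) ξ =
      𝓕 (fun t => RCLike.map 𝕜 ℂ (f t)) ξ + 𝓕 (fun t => RCLike.map 𝕜 ℂ (g t)) ξ := by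
  simp only [Real.fourier_eq]
  rw [← integral_add]
  · refine integral_congr_ae ?_
    filter_upwards [Lp.coeFn_add f g] with t ht
    rw [ht, Pi.add_apply, map_add, smul_add]
  · exact (Real.fourierIntegral_convergent_iff ξ).2 (integrable_toComplex f)
  · exact (Real.fourierIntegral_convergent_iff ξ).2 (integrable_toComplex g)

theorem fourier_toComplex_smul {𝕜 : Type*} [RCLike 𝕜] (c : 𝕜) (f : Lp 𝕜 1 (volume : Measure ℝ))
    (ξ : ℝ) : 𝓕 (fun t => RCLike.map 𝕜 ℂ ((c • f) t)) ξ =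
      RCLike.map 𝕜 ℂ c * 𝓕 (fun t => RCLike.map 𝕜 ℂ (f t)) ξ := by
  simp only [Real.fourier_eq]
  rw [← integral_const_mul]
  refine integral_congr_ae ?_
  filter_upwards [Lp.coeFn_smul c f] with t ht
  rw [ht, Pi.smul_apply, smul_eq_mul, map_mul_toComplex, mul_smul_comm]

theorem ae_eq_of_fourier_eq {u v : ℝ → ℂ} (hu : Integrable u) (hv : Integrable v)
    (h : ∀ ξ, 𝓕 u ξ = 𝓕 v ξ) : u =ᵐ[volume] v := by
  refine ae_eq_of_integral_contDiff_smul_eq hu.locallyIntegrable hv.locallyIntegrable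
    fun φ hφ hφc => ?_
  have hψc : HasCompactSupport (fun t => (φ t : ℂ)) :=
    hφc.comp_left (g := fun r : ℝ => (r : ℂ)) Complex.ofReal_zero
  have hψ : ContDiff ℝ (⊤ : ℕ∞) (fun t => (φ t : ℂ)) := Complex.ofRealCLM.contDiff.comp hφ
  set S : SchwartzMap ℝ ℂ := 𝓕⁻ (hψc.toSchwartzMap hψ) with hS
  have hSψ : ∀ t, 𝓕 (S : ℝ → ℂ) t = (φ t : ℂ) := fun t => by
    rw [← SchwartzMap.fourier_coe, hS, FourierTransform.fourier_fourierInv_eq]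
    rfl
  have key : ∀ w : ℝ → ℂ, Integrable w → ∫ t, φ t • w t = ∫ t, S t • 𝓕 w t := fun w hw => by
    have h1 := VectorFourier.integral_fourierIntegral_smul_eq_flip (L := innerₗ ℝ)
      Real.continuous_fourierChar continuous_inner (S.integrable (μ := volume)) hw
    rw [flip_innerₗ] at h1
    change ∫ t, 𝓕 (S : ℝ → ℂ) t • w t = ∫ t, S t • 𝓕 w t at h1
    rw [← h1]
    refine integral_congr_ae (Eventually.of_forall fun t => ?_)
    simp only [hSψ, Complex.real_smul, smul_eq_mul]
  rw [key u hu, key v hv]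
  simp only [h]

/-- The real Hardy space `H¹(ℝ) = {f ∈ L¹ : Hf ∈ L¹}` with the norm `‖f‖₁ + ‖Hf‖₁`, realised as
the space of pairs `(f, Hf)` inside the `ℓ¹`-direct sum `L¹ ⊕ L¹`
(`Hf` is determined by `f`, see `HardyOne.ext_fn`). -/
def HardyOne (𝕜 : Type*) [RCLike 𝕜] :
    Submodule 𝕜 (WithLp 1 (Lp 𝕜 1 (volume : Measure ℝ) × Lp 𝕜 1 (volume : Measure ℝ))) where
  carrier := {p | IsHilbertTransform (𝕜 := 𝕜) p.fst p.snd}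
  zero_mem' := fun ξ => by
    have h := fourier_toComplex_smul (𝕜 := 𝕜) 0 0 ξ
    rw [zero_smul, map_zero, zero_mul] at h
    simp only [WithLp.zero_fst, WithLp.zero_snd, h, mul_zero]
  add_mem' := fun {p q} hp hq ξ => by
    have h1 := hp ξ
    have h2 := hq ξ
    simp only [WithLp.add_fst, WithLp.add_snd, fourier_toComplex_add, h1, h2, mul_add]
  smul_mem' := fun c p hp ξ => by
    have h1 := hp ξ
    simp only [WithLp.smul_fst, WithLp.smul_snd, fourier_toComplex_smul, h1]
    ring

namespace HardyOne

variable {𝕜 : Type*} [RCLike 𝕜]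

/-- The function `f ∈ L¹(ℝ)` underlying an element of `H¹(ℝ)`. -/
def fn (f : HardyOne 𝕜) : Lp 𝕜 1 (volume : Measure ℝ) := f.1.fst

/-- The Hilbert transform `Hf ∈ L¹(ℝ)` of an element of `H¹(ℝ)`. -/
def hilbert (f : HardyOne 𝕜) : Lp 𝕜 1 (volume : Measure ℝ) := f.1.snd

theorem norm_eq (f : HardyOne 𝕜) : ‖f‖ = ‖fn f‖ + ‖hilbert f‖ := by
  change ‖f.1‖ = _
  rw [WithLp.prod_norm_eq_of_nat 1 (by simp)]
  simp [fn, hilbert]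

theorem ext_fn {f g : HardyOne 𝕜} (h : fn f = fn g) : f = g := by
  have hh : hilbert f = hilbert g := by
    have h1 := ae_eq_of_fourier_eq (integrable_toComplex (hilbert f))
      (integrable_toComplex (hilbert g)) fun ξ => by
        have hf := f.2 ξ
        have hg := g.2 ξ
        change _ = _ * 𝓕 (fun t => RCLike.map 𝕜 ℂ (fn f t)) ξ at hf
        rw [h] at hf
        exact hf.trans hg.symm
    refine Lp.ext ?_
    filter_upwards [h1] with t ht
    have hre := congrArg Complex.re ht
    have him := congrArg Complex.im ht
    simp [RCLike.map] at hre him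
    exact RCLike.ext hre him
  exact Subtype.ext (WithLp.ofLp_injective 1 (Prod.ext h hh))

end HardyOne

/-! ### The operator `𝐊` -/

/-- The Cauchy principal value of `∫ φ`, with singularity at `c`, exists and equals `v`. -/
def HasPV {𝕜 : Type*} [RCLike 𝕜] (φ : ℝ → 𝕜) (c : ℝ) (v : 𝕜) : Prop :=
  (∀ ε > 0, IntegrableOn φ {y | ε < |y - c|}) ∧
    Tendsto (fun ε : ℝ => ∫ y in {y | ε < |y - c|}, φ y) (𝓝[>] 0) (𝓝 v)

theorem MeasureTheory.Integrable.hasPV {𝕜 : Type*} [RCLike 𝕜] {φ : ℝ → 𝕜} (hφ : Integrable φ)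
    (c : ℝ) : HasPV φ c (∫ y, φ y) := by
  refine ⟨fun ε _ => hφ.integrableOn, ?_⟩
  have hm : ∀ ε : ℝ, MeasurableSet {y : ℝ | ε < |y - c|} := fun ε =>
    measurableSet_lt measurable_const (by fun_prop)
  simp only [← integral_indicator (hm _)]
  refine tendsto_integral_filter_of_dominated_convergence (fun y => ‖φ y‖)
    (Eventually.of_forall fun ε => hφ.aestronglyMeasurable.indicator (hm ε))
    (Eventually.of_forall fun ε => Eventually.of_forall fun y => norm_indicator_le_norm_self _ _)
    hφ.norm ?_
  filter_upwards [Measure.ae_ne volume c] with y hy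
  have hpos : 0 < |y - c| := abs_pos.2 (sub_ne_zero.2 hy)
  refine tendsto_const_nhds.congr' ?_
  filter_upwards [Ioo_mem_nhdsGT hpos] with ε hε
  exact (indicator_of_mem (s := {y : ℝ | ε < |y - c|}) hε.2 φ).symm

/-- `(𝐊 f)(x₁, x₂)` exists and equals `v`, where
`(𝐊 f)(x₁, x₂) = (1/π) ∫ (p.v. ∫ f(y₁, y₂) / (x₁ y₂ - x₂ y₁) dy₁) dy₂`.
The singularity of the inner integral is at `y₁ = x₁ y₂ / x₂` (for `x₂ = 0`, `y₂ ≠ 0` there is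
none and the choice of the point is irrelevant). The outer integral is required to converge
absolutely, so it is a fortiori a principal value, about any point (`MeasureTheory.Integrable.hasPV`). -/
def HasKValue {𝕜 : Type*} [RCLike 𝕜] (f : ℝ × ℝ → 𝕜) (x : ℝ × ℝ) (v : 𝕜) : Prop :=
  ∃ G : ℝ → 𝕜,
    (∀ᵐ y₂ : ℝ, HasPV (fun y₁ => f (y₁, y₂) / ((x.1 * y₂ - x.2 * y₁ : ℝ) : 𝕜))
      (x.1 * y₂ / x.2) (G y₂)) ∧
    Integrable G ∧ v = ((Real.pi⁻¹ : ℝ) : 𝕜) * ∫ y₂, G y₂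

end

/-! ### Approximate identities at Lebesgue points -/

/-! For `x₂ ≠ 0`, factoring `x₁y₂ - x₂y₁ = x₂(x₁y₂/x₂ - y₁)` shows that the inner principal value
for `f ⊗ g` is `(π/x₂) g(y₂) Hf(x₁y₂/x₂)`. Hence `𝐊(f ⊗ g)(x) = x₂⁻¹ ∫ g(y) Hf(x₁y/x₂) dy`, and
substituting `u = x₁y/x₂` bounds it by `‖Hf‖₁ ‖g‖_∞ |x₁|⁻¹`: the Jacobian `|x₂/x₁|` cancels `|x₂|⁻¹`
(`norm_integral_kernelSlice_le`). On the line `x₂ = 0` the value is `0`, because functions in `H¹`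
have mean zero. Solidity of `F` turns the pointwise bound into `‖𝐊(f ⊗ g)‖ ≤ ‖w₁‖ ‖f‖ ‖g‖`
(`kernelClass_mem`), and a bounded bilinear map extends to the completed projective tensor product
with the same constant (`CompletedProjTensor.exists_extension`).

The analytic point is that `Hf`, defined as a Fourier multiplier, is a.e. a principal value
(`IsHilbertTransform.ae_hasPV`). Since `Hf + if` and `Hf - if` have one-sided spectra, their Cauchy
integrals vanish in the upper and lower half-planes respectively. Combining the two, the Poisson
integral of `Hf` equals the conjugate Poisson integral of `f`. As `t → 0` the former tends to `π
Hf(x)` at Lebesgue points. The conjugate Poisson kernel differs from the truncated kernel `1/u` by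
an odd function dominated by the Poisson kernel, which contributes nothing in the limit. -/

theorem exists_dyadic_poisson_le {t : ℝ} (ht : 0 < t) (u : ℝ) :
    ∃ k : ℕ, |u| ≤ 2 ^ k * t ∧ t / (t ^ 2 + u ^ 2) ≤ 4 / t * (1 / 4) ^ k := by
  rcases le_or_gt |u| t with h | h
  · refine ⟨0, by simpa using h, ?_⟩
    rw [pow_zero, mul_one, div_le_div_iff₀ (by positivity) ht]
    nlinarith [sq_nonneg u, sq_nonneg t]
  · obtain ⟨k, hk1, hk2⟩ := exists_nat_pow_near (x := |u| / t) (y := (2 : ℝ))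
      ((one_le_div ht).2 h.le) one_lt_two
    refine ⟨k + 1, ((div_lt_iff₀ ht).1 hk2).le, ?_⟩
    have h1 : 2 ^ k * t ≤ |u| := (le_div_iff₀ ht).1 hk1
    have h2 : (2 ^ k * t) ^ 2 ≤ u ^ 2 := by
      rw [← sq_abs u]
      exact pow_le_pow_left₀ (by positivity) h1 2
    have h3 : ((2 : ℝ) ^ k) ^ 2 = 4 ^ k := by rw [← pow_mul, mul_comm, pow_mul]; norm_num
    rw [mul_pow, h3] at h2
    have h5 : 4 / t * (1 / 4) ^ (k + 1) = t / (4 ^ k * t ^ 2) := by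
      rw [pow_succ, one_div_pow]
      field_simp
    rw [h5]
    exact div_le_div_of_nonneg_left ht.le (by positivity) (by nlinarith)

/-- The Poisson kernel lies below a sum of multiples of indicators of the balls of radius `2^k t`.
The weight `8 · 2^{-k}` is the height `(4/t) 4^{-k}` times the ball's length `2 · 2^k t`. The bound
`C` serves only to make the series converge. -/
theorem integral_mul_poisson_le {g : ℝ → ℝ} (hg0 : ∀ y, 0 ≤ g y) (hg : LocallyIntegrable g)
    (x : ℝ) {C : ℝ} (hC : ∀ r > 0, ⨍ y in Metric.closedBall x r, g y ≤ C) {t : ℝ} (ht : 0 < t) :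
    ∫ y, g y * (t / (t ^ 2 + (x - y) ^ 2)) ≤
      ∑' k : ℕ, 8 * (1 / 2) ^ k * ⨍ y in Metric.closedBall x (2 ^ k * t), g y := by
  have havg0 : ∀ r, 0 ≤ ⨍ y in Metric.closedBall x r, g y := fun r => by
    rw [setAverage_eq]
    exact smul_nonneg (by positivity) (integral_nonneg hg0)
  have hsum : Summable fun k : ℕ =>
      8 * (1 / 2) ^ k * ⨍ y in Metric.closedBall x (2 ^ k * t), g y := by
    refine Summable.of_nonneg_of_le (fun k => mul_nonneg (by positivity) (havg0 _))
      (fun k => mul_le_mul_of_nonneg_left (hC _ (by positivity)) (by positivity))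
      ((summable_geometric_two.mul_left 8).mul_right C)
  have hint : ∀ r, IntegrableOn g (Metric.closedBall x r) := fun r =>
    hg.integrableOn_isCompact (isCompact_closedBall x r)
  have hm := hg.aestronglyMeasurable
  have hm' : AEStronglyMeasurable (fun y => g y * (t / (t ^ 2 + (x - y) ^ 2))) :=
    hm.mul (by fun_prop : Measurable fun y : ℝ => t / (t ^ 2 + (x - y) ^ 2)).aestronglyMeasurable
  rw [integral_eq_lintegral_of_nonneg_ae
    (Eventually.of_forall fun y => mul_nonneg (hg0 y) (by positivity)) hm']
  refine ENNReal.toReal_le_of_le_ofReal (tsum_nonneg fun k => mul_nonneg (by positivity) (havg0 _)) ?_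
  calc ∫⁻ y, ENNReal.ofReal (g y * (t / (t ^ 2 + (x - y) ^ 2)))
      ≤ ∫⁻ y, ∑' k : ℕ, (Metric.closedBall x (2 ^ k * t)).indicator
          (fun y => ENNReal.ofReal (4 / t * (1 / 4) ^ k * g y)) y := by
        refine lintegral_mono fun y => ?_
        obtain ⟨k, hk1, hk2⟩ := exists_dyadic_poisson_le ht (x - y)
        refine le_trans ?_ (ENNReal.le_tsum k)
        rw [indicator_of_mem]
        · refine ENNReal.ofReal_le_ofReal ?_
          rw [mul_comm]
          exact mul_le_mul_of_nonneg_right hk2 (hg0 y)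
        · rwa [Metric.mem_closedBall, dist_comm, Real.dist_eq]
    _ = ∑' k : ℕ, ENNReal.ofReal (8 * (1 / 2) ^ k *
          ⨍ y in Metric.closedBall x (2 ^ k * t), g y) := by
        rw [lintegral_tsum]
        · refine tsum_congr fun k => ?_
          rw [lintegral_indicator measurableSet_closedBall,
            ← ofReal_integral_eq_lintegral_ofReal ((hint _).const_mul _)
              (Eventually.of_forall fun y => mul_nonneg (by positivity) (hg0 y)),
            integral_const_mul, setAverage_eq, Real.volume_real_closedBall (by positivity),
            smul_eq_mul]
          congr 1
          have h3 : (4 : ℝ) ^ k = 2 ^ k * 2 ^ k := by rw [← mul_pow]; norm_num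
          rw [one_div_pow, one_div_pow, h3]
          field_simp
          ring_nf
        · intro k
          exact (hm.aemeasurable.const_mul _).ennreal_ofReal.indicator measurableSet_closedBall
    _ = ENNReal.ofReal (∑' k : ℕ, 8 * (1 / 2) ^ k *
          ⨍ y in Metric.closedBall x (2 ^ k * t), g y) :=
        (ENNReal.ofReal_tsum_of_nonneg (fun k => mul_nonneg (by positivity) (havg0 _)) hsum).symm

/-- Each term of the dyadic series tends to zero, and `C` times a geometric series dominates
uniformly in `t`. -/
theorem tendsto_integral_mul_poisson_zero {g : ℝ → ℝ} (hg0 : ∀ y, 0 ≤ g y)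
    (hg : LocallyIntegrable g) (x : ℝ) {C : ℝ}
    (hC : ∀ r > 0, ⨍ y in Metric.closedBall x r, g y ≤ C)
    (h0 : Tendsto (fun r => ⨍ y in Metric.closedBall x r, g y) (𝓝[>] 0) (𝓝 0)) :
    Tendsto (fun t : ℝ => ∫ y, g y * (t / (t ^ 2 + (x - y) ^ 2))) (𝓝[>] 0) (𝓝 0) := by
  have havg0 : ∀ r, 0 ≤ ⨍ y in Metric.closedBall x r, g y := fun r => by
    rw [setAverage_eq]
    exact smul_nonneg (by positivity) (integral_nonneg hg0)
  have hlim : Tendsto (fun t : ℝ => ∑' k : ℕ, 8 * (1 / 2) ^ k *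
      ⨍ y in Metric.closedBall x (2 ^ k * t), g y) (𝓝[>] 0) (𝓝 (∑' _ : ℕ, (0 : ℝ))) := by
    refine tendsto_tsum_of_dominated_convergence
      ((summable_geometric_two.mul_left 8).mul_right C) (fun k => ?_) ?_
    · have hk : Tendsto (fun t : ℝ => 2 ^ k * t) (𝓝[>] 0) (𝓝[>] 0) := by
        refine tendsto_nhdsWithin_iff.2 ⟨?_, ?_⟩
        · have : Tendsto (fun t : ℝ => 2 ^ k * t) (𝓝 0) (𝓝 (2 ^ k * 0)) :=
            (continuous_const.mul continuous_id).tendsto 0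
          rw [mul_zero] at this
          exact this.mono_left nhdsWithin_le_nhds
        · filter_upwards [self_mem_nhdsWithin] with t ht
          exact mul_pos (pow_pos (two_pos : (0 : ℝ) < 2) k) (show (0 : ℝ) < t from ht)
      have := (h0.comp hk).const_mul (8 * (1 / 2) ^ k : ℝ)
      rw [mul_zero] at this
      exact this
    · filter_upwards [self_mem_nhdsWithin] with t ht k
      have ht' : (0 : ℝ) < t := ht
      rw [Real.norm_of_nonneg (mul_nonneg (by positivity) (havg0 _))]
      exact mul_le_mul_of_nonneg_left (hC _ (by positivity)) (by positivity)
  rw [tsum_zero] at hlim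
  refine squeeze_zero' ?_ ?_ hlim
  · filter_upwards [self_mem_nhdsWithin] with t ht
    have ht' : (0 : ℝ) < t := ht
    exact integral_nonneg fun y => mul_nonneg (hg0 y) (by positivity)
  · filter_upwards [self_mem_nhdsWithin] with t ht
    exact integral_mul_poisson_le hg0 hg x hC ht

theorem ae_tendsto_integral_norm_sub_mul_poisson {E : Type*} [NormedAddCommGroup E] {f : ℝ → E}
    (hf : Integrable f) :
    ∀ᵐ x : ℝ, Tendsto (fun t : ℝ => ∫ y, ‖f y - f x‖ * (t / (t ^ 2 + (x - y) ^ 2)))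
      (𝓝[>] 0) (𝓝 0) := by
  filter_upwards [IsUnifLocDoublingMeasure.ae_tendsto_average_norm_sub (volume : Measure ℝ)
    hf.locallyIntegrable 1] with x hx
  have h0 : Tendsto (fun r => ⨍ y in Metric.closedBall x r, ‖f y - f x‖) (𝓝[>] 0) (𝓝 0) := by
    refine hx (fun _ => x) id tendsto_id ?_
    filter_upwards [self_mem_nhdsWithin] with r hr
    exact Metric.mem_closedBall_self (by simpa using (le_of_lt hr : (0 : ℝ) ≤ r))
  obtain ⟨δ, hδ, hδ'⟩ : ∃ δ > 0, ∀ r, 0 < r → r < δ →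
      ⨍ y in Metric.closedBall x r, ‖f y - f x‖ < 1 := by
    obtain ⟨δ, hδ, h⟩ := mem_nhdsGT_iff_exists_Ioo_subset.1 (h0.eventually_lt_const one_pos)
    exact ⟨δ, hδ, fun r h1 h2 => h ⟨h1, h2⟩⟩
  -- Averages over radii below `δ` are less than `1` by the Lebesgue point property; for `r ≥ δ` the
  -- ball has length at least `2δ`, so `‖f‖₁/(2δ) + ‖f x‖` bounds the average.
  refine tendsto_integral_mul_poisson_zero (C := max 1 ((∫ y, ‖f y‖) / (2 * δ) + ‖f x‖))
    (fun y => norm_nonneg _)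
    (fun y => by
      obtain ⟨s, hs, hi⟩ := (hf.locallyIntegrable.sub (locallyIntegrable_const (f x))) y
      exact ⟨s, hs, hi.norm⟩) x (fun r hr => ?_) h0
  rcases lt_or_ge r δ with h | h
  · exact (hδ' r hr h).le.trans (le_max_left _ _)
  · refine le_trans ?_ (le_max_right _ _)
    have hle : ∫ y in Metric.closedBall x r, ‖f y - f x‖ ≤ (∫ y, ‖f y‖) + 2 * r * ‖f x‖ := by
      have hfin : volume (Metric.closedBall x r) ≠ ∞ := measure_closedBall_lt_top.ne
      calc ∫ y in Metric.closedBall x r, ‖f y - f x‖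
          ≤ ∫ y in Metric.closedBall x r, (‖f y‖ + ‖f x‖) := by
            refine integral_mono (hf.integrableOn.sub (integrableOn_const hfin)).norm
              (hf.norm.integrableOn.add (integrableOn_const hfin)) fun y => norm_sub_le _ _
        _ = (∫ y in Metric.closedBall x r, ‖f y‖) + 2 * r * ‖f x‖ := by
            rw [integral_add hf.norm.integrableOn (integrableOn_const hfin), setIntegral_const,
              Real.volume_real_closedBall hr.le, smul_eq_mul]
        _ ≤ _ := by
            gcongr
            · exact Eventually.of_forall fun y => norm_nonneg _
            · exact hf.norm
            · exact Measure.restrict_le_self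
    rw [setAverage_eq, Real.volume_real_closedBall hr.le, smul_eq_mul]
    calc (2 * r)⁻¹ * ∫ y in Metric.closedBall x r, ‖f y - f x‖
        ≤ (2 * r)⁻¹ * ((∫ y, ‖f y‖) + 2 * r * ‖f x‖) := by gcongr
      _ = (∫ y, ‖f y‖) / (2 * r) + ‖f x‖ := by field_simp
      _ ≤ _ := by gcongr

/-! ### The Hilbert transform as a boundary value -/

/-- Up to a constant, `1/(z - y)` is the Fourier transform of `e^{2πizξ}` restricted to `ξ > 0`,
which is integrable because `Im z > 0`. The multiplication formula moves the transform onto `w`,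
where it vanishes. -/
theorem integral_div_sub_eq_zero_of_fourier {w : ℝ → ℂ} (hw : Integrable w)
    (h : ∀ ξ : ℝ, 0 < ξ → 𝓕 w ξ = 0) {z : ℂ} (hz : 0 < z.im) :
    ∫ y : ℝ, w y / (z - y) = 0 := by
  have hre : ∀ y : ℝ, (2 * Real.pi * Complex.I * (z - y)).re < 0 := fun y => by
    have : (2 * Real.pi * Complex.I * (z - y)).re = -(2 * Real.pi * z.im) := by
      simp [Complex.mul_re, Complex.mul_im]
    rw [this]
    have := Real.pi_pos
    simp only [Left.neg_neg_iff]
    positivity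
  set φ : ℝ → ℂ := (Ioi (0 : ℝ)).indicator
    (fun ξ => Complex.exp (2 * Real.pi * Complex.I * z * ξ)) with hφ
  have hφi : Integrable φ := by
    rw [hφ, integrable_indicator_iff measurableSet_Ioi]
    have := hre 0
    rw [Complex.ofReal_zero, sub_zero] at this
    exact integrableOn_exp_mul_complex_Ioi this 0
  have hφF : ∀ y : ℝ, 𝓕 φ y = -(2 * Real.pi * Complex.I)⁻¹ * (z - y)⁻¹ := fun y => by
    have h1 : 𝓕 φ y = ∫ ξ in Ioi (0 : ℝ), Complex.exp (2 * Real.pi * Complex.I * (z - y) * ξ) := by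
      rw [Real.fourier_real_eq_integral_exp_smul, ← integral_indicator measurableSet_Ioi]
      congr 1
      ext ξ
      simp only [hφ, indicator]
      split_ifs
      · rw [smul_eq_mul, ← Complex.exp_add]
        congr 1
        push_cast
        ring
      · simp
    rw [h1, integral_exp_mul_complex_Ioi (hre y) 0]
    simp only [Complex.ofReal_zero, mul_zero, Complex.exp_zero, mul_inv, neg_div, one_div]
    ring
  have h1 := VectorFourier.integral_fourierIntegral_smul_eq_flip (L := innerₗ ℝ)
    Real.continuous_fourierChar continuous_inner hφi hw
  rw [flip_innerₗ] at h1
  change ∫ t, 𝓕 φ t • w t = ∫ t, φ t • 𝓕 w t at h1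
  have h2 : ∀ t, φ t • 𝓕 w t = 0 := fun t => by
    by_cases ht : 0 < t
    · rw [h t ht, smul_zero]
    · simp [hφ, ht]
  simp only [h2, integral_zero, hφF, smul_eq_mul, mul_assoc] at h1
  rw [integral_const_mul] at h1
  have h3 : (-(2 * (Real.pi * Complex.I))⁻¹ : ℂ) ≠ 0 := by
    simp [Real.pi_ne_zero]
  have h4 := (mul_eq_zero.1 h1).resolve_left h3
  rw [← h4]
  congr 1
  ext y
  rw [div_eq_mul_inv, mul_comm]

theorem integral_div_sub_eq_zero_of_fourier' {w : ℝ → ℂ} (hw : Integrable w)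
    (h : ∀ ξ : ℝ, ξ < 0 → 𝓕 w ξ = 0) {z : ℂ} (hz : z.im < 0) :
    ∫ y : ℝ, w y / (z - y) = 0 := by
  have h1 := integral_div_sub_eq_zero_of_fourier (w := fun y => w (-y)) hw.comp_neg
    (fun ξ hξ => by
      rw [← h (-ξ) (by linarith), Real.fourier_real_eq_integral_exp_smul,
        Real.fourier_real_eq_integral_exp_smul, ← integral_neg_eq_self]
      congr 1
      ext y
      simp) (z := -z) (by simpa using hz)
  rw [← integral_neg_eq_self, ← neg_eq_zero, ← integral_neg, ← h1]
  congr 1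
  ext y
  rw [← div_neg]
  congr 1
  push_cast
  ring

theorem integrable_smul_of_abs_le {E : Type*} [NormedAddCommGroup E] [NormedSpace ℝ E]
    {f : ℝ → E} (hf : Integrable f) {k : ℝ → ℝ} (hk : Measurable k) {C : ℝ} (hC : ∀ y, |k y| ≤ C) :
    Integrable fun y => k y • f y :=
  hf.bdd_smul C hk.aestronglyMeasurable (Eventually.of_forall hC)

theorem abs_poisson_le {t : ℝ} (ht : 0 < t) (u : ℝ) : |t / (t ^ 2 + u ^ 2)| ≤ 1 / t := by
  rw [abs_of_pos (by positivity), div_le_div_iff₀ (by positivity) ht]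
  nlinarith [sq_nonneg u]

theorem abs_conjPoisson_le {t : ℝ} (ht : 0 < t) (u : ℝ) : |u / (t ^ 2 + u ^ 2)| ≤ 1 / t := by
  rw [abs_div, abs_of_pos (show 0 < t ^ 2 + u ^ 2 by positivity),
    div_le_div_iff₀ (by positivity) ht]
  nlinarith [sq_nonneg (|u| - t), sq_abs u, sq_nonneg t]

theorem integral_poisson_eq_conjPoisson_complex {f h : ℝ → ℂ} (hf : Integrable f)
    (hh : Integrable h)
    (hfh : ∀ ξ : ℝ, 𝓕 h ξ = -Complex.I * (SignType.sign ξ : ℂ) * 𝓕 f ξ)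
    (x : ℝ) {t : ℝ} (ht : 0 < t) :
    ∫ y, (t / (t ^ 2 + (x - y) ^ 2)) • h y = ∫ y, ((x - y) / (t ^ 2 + (x - y) ^ 2)) • f y := by
  have hlin : ∀ (c : ℂ) (ξ : ℝ), 𝓕 (fun y => h y + c * f y) ξ = 𝓕 h ξ + c * 𝓕 f ξ := by
    intro c ξ
    simp only [Real.fourier_eq]
    rw [← integral_const_mul, ← integral_add]
    · refine integral_congr_ae (Eventually.of_forall fun y => ?_)
      simp only [smul_add, mul_smul_comm]
    · exact (Real.fourierIntegral_convergent_iff ξ).2 hh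
    · exact ((Real.fourierIntegral_convergent_iff ξ).2 hf).const_mul c
  have h1 := integral_div_sub_eq_zero_of_fourier (w := fun y => h y + Complex.I * f y)
    (hh.add (hf.const_mul _)) (fun ξ hξ => by
      rw [hlin, hfh, sign_pos hξ]; simp) (z := x + t * Complex.I) (by simpa using ht)
  have h2 := integral_div_sub_eq_zero_of_fourier' (w := fun y => h y + -Complex.I * f y)
    (hh.add (hf.const_mul _)) (fun ξ hξ => by
      rw [hlin, hfh, sign_neg hξ]; simp) (z := x - t * Complex.I) (by simpa using ht)
  have hP : ∀ {g : ℝ → ℂ}, Integrable g →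
      Integrable fun y => (t / (t ^ 2 + (x - y) ^ 2)) • g y := fun hg =>
    integrable_smul_of_abs_le hg (by fun_prop) fun y => abs_poisson_le ht (x - y)
  have hQ : ∀ {g : ℝ → ℂ}, Integrable g →
      Integrable fun y => ((x - y) / (t ^ 2 + (x - y) ^ 2)) • g y := fun hg =>
    integrable_smul_of_abs_le hg (by fun_prop) fun y => abs_conjPoisson_le ht (x - y)
  have hd : ∀ y : ℝ, ((t : ℂ) ^ 2 + (x - y) ^ 2) ≠ 0 := fun y => by
    have : t ^ 2 + (x - y) ^ 2 ≠ 0 := by positivity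
    exact_mod_cast this
  have hmul : ∀ y : ℝ, (x + t * Complex.I - y : ℂ) * (x - t * Complex.I - y) =
      t ^ 2 + (x - y) ^ 2 := fun y => by
    linear_combination (-(t : ℂ) ^ 2) * Complex.I_sq
  -- The Cauchy kernel at `x ± it` is the conjugate Poisson kernel `∓ i` times the Poisson kernel;
  -- subtracting the two vanishing integrals leaves only the terms in the final identity.
  have e1 : ∀ (y : ℝ) (a : ℂ), a / (x + t * Complex.I - y) =
      ((x - y) / (t ^ 2 + (x - y) ^ 2)) • a - Complex.I * ((t / (t ^ 2 + (x - y) ^ 2)) • a) := by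
    intro y a
    have hn := left_ne_zero_of_mul ((hmul y).trans_ne (hd y))
    rw [div_eq_iff hn, Complex.real_smul, Complex.real_smul]
    push_cast
    have := hd y
    field_simp
    rw [← hmul y]
    ring
  have e2 : ∀ (y : ℝ) (a : ℂ), a / (x - t * Complex.I - y) =
      ((x - y) / (t ^ 2 + (x - y) ^ 2)) • a + Complex.I * ((t / (t ^ 2 + (x - y) ^ 2)) • a) := by
    intro y a
    have hn := right_ne_zero_of_mul ((hmul y).trans_ne (hd y))
    rw [div_eq_iff hn, Complex.real_smul, Complex.real_smul]
    push_cast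
    have := hd y
    field_simp
    rw [← hmul y]
    ring
  have hi : Integrable fun y => h y + Complex.I * f y := hh.add (hf.const_mul _)
  have hi' : Integrable fun y => h y + -Complex.I * f y := hh.add (hf.const_mul _)
  simp only [e1] at h1
  simp only [e2] at h2
  rw [integral_sub (hQ hi) ((hP hi).const_mul _), integral_const_mul] at h1
  rw [integral_add (hQ hi') ((hP hi').const_mul _), integral_const_mul] at h2
  simp only [smul_add, ← mul_smul_comm] at h1 h2
  rw [integral_add (hQ hh) ((hQ hf).const_mul _), integral_add (hP hh) ((hP hf).const_mul _),
    integral_const_mul, integral_const_mul] at h1 h2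
  linear_combination (Complex.I / 2) * (h1 - h2) -
    ((∫ y, ((x - y) / (t ^ 2 + (x - y) ^ 2)) • f y) -
      ∫ y, (t / (t ^ 2 + (x - y) ^ 2)) • h y) * Complex.I_sq

theorem toComplex_injective {𝕜 : Type*} [RCLike 𝕜] : Function.Injective (RCLike.map 𝕜 ℂ) := by
  intro a b hab
  have hre := congrArg Complex.re hab
  have him := congrArg Complex.im hab
  simp [RCLike.map] at hre him
  exact RCLike.ext hre him

namespace IsHilbertTransform

variable {𝕜 : Type*} [RCLike 𝕜] {f h : ℝ → 𝕜}

theorem integral_poisson_eq (hfh : IsHilbertTransform f h) (hf : Integrable f) (hh : Integrable h)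
    (x : ℝ) {t : ℝ} (ht : 0 < t) :
    ∫ y, (t / (t ^ 2 + (x - y) ^ 2)) • h y = ∫ y, ((x - y) / (t ^ 2 + (x - y) ^ 2)) • f y := by
  refine toComplex_injective ?_
  rw [← ContinuousLinearMap.integral_comp_comm _
      (integrable_smul_of_abs_le hh (by fun_prop) fun y => abs_poisson_le ht (x - y)),
    ← ContinuousLinearMap.integral_comp_comm _
      (integrable_smul_of_abs_le hf (by fun_prop) fun y => abs_conjPoisson_le ht (x - y))]
  simp only [map_smul]
  exact integral_poisson_eq_conjPoisson_complex ((RCLike.map 𝕜 ℂ).integrable_comp hf)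
    ((RCLike.map 𝕜 ℂ).integrable_comp hh) hfh x ht

/-- Both transforms are continuous, and `sgn 0 = 0` forces that of `h` to vanish at `0`. For `ξ > 0`
the transform of `f` is `i` times that of `h`, so it also tends to `0`, its limit being `∫ f`. -/
theorem integral_eq_zero (hfh : IsHilbertTransform f h) (hf : Integrable f) (hh : Integrable h) :
    ∫ y, f y = 0 := by
  refine toComplex_injective ?_
  rw [← ContinuousLinearMap.integral_comp_comm _ hf, map_zero]
  have hc : ∀ {g : ℝ → 𝕜}, Integrable g →
      Continuous (𝓕 (fun t => RCLike.map 𝕜 ℂ (g t))) := fun hg =>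
    VectorFourier.fourierIntegral_continuous Real.continuous_fourierChar
      (by exact continuous_inner) ((RCLike.map 𝕜 ℂ).integrable_comp hg)
  have h0 : 𝓕 (fun t => RCLike.map 𝕜 ℂ (h t)) 0 = 0 := by
    rw [hfh 0]; simp
  have h1 : Tendsto (𝓕 (fun t => RCLike.map 𝕜 ℂ (h t))) (𝓝[>] 0) (𝓝 0) := by
    have := ((hc hh).tendsto 0).mono_left (nhdsWithin_le_nhds (s := Ioi 0))
    rwa [h0] at this
  have h2 : Tendsto (𝓕 (fun t => RCLike.map 𝕜 ℂ (f t))) (𝓝[>] 0) (𝓝 0) := by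
    have h3 := h1.const_mul Complex.I
    rw [mul_zero] at h3
    refine h3.congr' ?_
    filter_upwards [self_mem_nhdsWithin] with ξ hξ
    rw [hfh ξ, sign_pos hξ]
    simp [← mul_assoc]
  have h3 := tendsto_nhds_unique h2 (((hc hf).tendsto 0).mono_left nhdsWithin_le_nhds)
  rw [Real.fourier_real_eq_integral_exp_smul] at h3
  simpa using h3.symm

end IsHilbertTransform

/-! ### Comparing the Poisson, conjugate Poisson and truncated kernels. -/

theorem integral_poisson {t : ℝ} (ht : 0 < t) (x : ℝ) :
    ∫ y, t / (t ^ 2 + (x - y) ^ 2) = Real.pi := by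
  rw [integral_sub_left_eq_self (fun u : ℝ => t / (t ^ 2 + u ^ 2)) volume x]
  have h1 := Measure.integral_comp_mul_left (fun u : ℝ => (1 + u ^ 2)⁻¹) t⁻¹
  rw [integral_univ_inv_one_add_sq, inv_inv, abs_of_pos ht, smul_eq_mul] at h1
  have h2 : ∀ u : ℝ, t / (t ^ 2 + u ^ 2) = t⁻¹ * (1 + (t⁻¹ * u) ^ 2)⁻¹ := fun u => by
    field_simp
  simp only [h2]
  rw [integral_const_mul, h1]
  field_simp

theorem integrable_poisson {t : ℝ} (ht : 0 < t) (x : ℝ) :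
    Integrable fun y => t / (t ^ 2 + (x - y) ^ 2) :=
  -- A non-integrable function would have integral `0` by convention, not `π`.
  not_imp_comm.1 integral_undef (by rw [integral_poisson ht x]; exact Real.pi_ne_zero)

/-- The kernel `1 / u` truncated at `|u| ≤ t`. -/
noncomputable def truncInv (t u : ℝ) : ℝ := if t < |u| then u⁻¹ else 0

theorem measurable_truncInv (t : ℝ) : Measurable (truncInv t) :=
  Measurable.ite (measurableSet_lt measurable_const (by fun_prop)) measurable_inv measurable_const

theorem truncInv_neg (t u : ℝ) : truncInv t (-u) = -truncInv t u := by
  simp only [truncInv, abs_neg, inv_neg]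
  split_ifs <;> simp

theorem abs_truncInv_le {t : ℝ} (ht : 0 < t) (u : ℝ) : |truncInv t u| ≤ 1 / t := by
  unfold truncInv
  split_ifs with h
  · rw [abs_inv, ← one_div]
    exact one_div_le_one_div_of_le ht h.le
  · simp [ht.le]

theorem abs_conjPoisson_sub_truncInv_le {t : ℝ} (ht : 0 < t) (u : ℝ) :
    |u / (t ^ 2 + u ^ 2) - truncInv t u| ≤ t / (t ^ 2 + u ^ 2) := by
  unfold truncInv
  have hd : 0 < t ^ 2 + u ^ 2 := by positivity
  split_ifs with h
  · have hu : 0 < |u| := ht.trans h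
    have hu0 : u ≠ 0 := abs_pos.1 hu
    have h1 : u / (t ^ 2 + u ^ 2) - u⁻¹ = -(t ^ 2 / u / (t ^ 2 + u ^ 2)) := by
      field_simp
      ring
    rw [h1, abs_neg, abs_div, abs_of_pos hd, abs_div, abs_of_pos (pow_pos ht 2)]
    gcongr
    rw [div_le_iff₀ hu]
    nlinarith
  · rw [sub_zero, abs_div, abs_of_pos hd]
    gcongr
    exact not_lt.1 h

theorem measurable_conjPoisson_sub_truncInv (t x : ℝ) :
    Measurable fun y => (x - y) / (t ^ 2 + (x - y) ^ 2) - truncInv t (x - y) :=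
  Measurable.sub (by fun_prop) ((measurable_truncInv t).comp (by fun_prop))

/-- The integrand is odd about `x`; with the convention for undefined integrals this needs no
integrability. -/
theorem integral_conjPoisson_sub_truncInv (t x : ℝ) :
    ∫ y, ((x - y) / (t ^ 2 + (x - y) ^ 2) - truncInv t (x - y)) = 0 := by
  rw [integral_sub_left_eq_self (fun u : ℝ => u / (t ^ 2 + u ^ 2) - truncInv t u) volume x]
  have h := integral_neg_eq_self (fun u : ℝ => u / (t ^ 2 + u ^ 2) - truncInv t u) volume
  have h1 : ∀ u : ℝ, -u / (t ^ 2 + (-u) ^ 2) - truncInv t (-u) =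
      -(u / (t ^ 2 + u ^ 2) - truncInv t u) := fun u => by
    rw [truncInv_neg, neg_sq]
    ring
  simp only [h1] at h
  rw [integral_neg] at h
  linarith

/-- A family of kernels of constant integral `a` dominated by the Poisson kernel reproduces
`a • f x` at every point where the oscillation of `f` is negligible. -/
theorem tendsto_integral_smul_of_abs_le_poisson {E : Type*} [NormedAddCommGroup E]
    [NormedSpace ℝ E] [CompleteSpace E] {f : ℝ → E} (hf : Integrable f) {x : ℝ}
    (hx : Tendsto (fun t : ℝ => ∫ y, ‖f y - f x‖ * (t / (t ^ 2 + (x - y) ^ 2))) (𝓝[>] 0) (𝓝 0))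
    {k : ℝ → ℝ → ℝ} (hkm : ∀ t, Measurable (k t))
    (hk : ∀ t > 0, ∀ y, |k t y| ≤ t / (t ^ 2 + (x - y) ^ 2)) {a : ℝ}
    (hka : ∀ t > 0, ∫ y, k t y = a) :
    Tendsto (fun t : ℝ => ∫ y, k t y • f y) (𝓝[>] 0) (𝓝 (a • f x)) := by
  have hki : ∀ t > 0, Integrable (k t) := fun t ht =>
    (integrable_poisson ht x).mono' (hkm t).aestronglyMeasurable (Eventually.of_forall (hk t ht))
  have hkf : ∀ t > 0, Integrable fun y => k t y • f y := fun t ht =>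
    integrable_smul_of_abs_le hf (hkm t) fun y =>
      (hk t ht y).trans ((le_abs_self _).trans (abs_poisson_le ht (x - y)))
  rw [tendsto_iff_norm_sub_tendsto_zero]
  refine squeeze_zero' (Eventually.of_forall fun t => norm_nonneg _) ?_ hx
  filter_upwards [self_mem_nhdsWithin] with t ht
  have ht' : 0 < t := ht
  -- Writing `a • f x` as `∫ k t y • f x` makes the error an integral of `k t y • (f y - f x)`.
  rw [← hka t ht', ← integral_smul_const, ← integral_sub (hkf t ht') ((hki t ht').smul_const _)]
  refine norm_integral_le_of_norm_le ?_ (Eventually.of_forall fun y => ?_)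
  · have h1 := integrable_smul_of_abs_le hf.norm
      (by fun_prop : Measurable fun y => t / (t ^ 2 + (x - y) ^ 2))
      fun y => abs_poisson_le ht' (x - y)
    have h2 := (integrable_poisson ht' x).const_mul ‖f x‖
    refine (h1.add h2).mono' ?_ (Eventually.of_forall fun y => ?_)
    · exact (hf.aestronglyMeasurable.sub aestronglyMeasurable_const).norm.mul
        (by fun_prop : Measurable fun y => t / (t ^ 2 + (x - y) ^ 2)).aestronglyMeasurable
    · have h3 : 0 ≤ t / (t ^ 2 + (x - y) ^ 2) := by positivity
      rw [Real.norm_of_nonneg (mul_nonneg (norm_nonneg _) h3), Pi.add_apply, smul_eq_mul,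
        mul_comm _ ‖f y‖, ← add_mul]
      exact mul_le_mul_of_nonneg_right (norm_sub_le _ _) h3
  · rw [← smul_sub, norm_smul, mul_comm]
    exact mul_le_mul_of_nonneg_left (hk t ht' y) (norm_nonneg _)

/-- The principal value integral of the Hilbert transform exists almost everywhere. -/
theorem IsHilbertTransform.ae_hasPV {𝕜 : Type*} [RCLike 𝕜] {f h : ℝ → 𝕜}
    (hfh : IsHilbertTransform f h) (hf : Integrable f) (hh : Integrable h) :
    ∀ᵐ x : ℝ, HasPV (fun y => f y / ((x - y : ℝ) : 𝕜)) x (Real.pi • h x) := by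
  filter_upwards [ae_tendsto_integral_norm_sub_mul_poisson hf,
    ae_tendsto_integral_norm_sub_mul_poisson hh] with x hxf hxh
  have hS : ∀ t : ℝ, MeasurableSet {y : ℝ | t < |y - x|} := fun t =>
    measurableSet_lt measurable_const (by fun_prop)
  have htr : ∀ t > 0, Integrable fun y => truncInv t (x - y) • f y := fun t ht =>
    integrable_smul_of_abs_le hf ((measurable_truncInv t).comp (by fun_prop))
      fun y => abs_truncInv_le ht (x - y)
  have hind : ∀ t : ℝ, {y : ℝ | t < |y - x|}.indicator (fun y => f y / ((x - y : ℝ) : 𝕜)) =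
      fun y => truncInv t (x - y) • f y := fun t => by
    ext y
    simp only [indicator, mem_ofPred_eq, truncInv, abs_sub_comm y x]
    split_ifs
    · rw [div_eq_inv_mul, RCLike.real_smul_eq_coe_mul, RCLike.ofReal_inv]
    · simp
  refine ⟨fun t ht => ?_, ?_⟩
  · rw [← integrable_indicator_iff (hS t), hind]
    exact htr t ht
  · simp only [← integral_indicator (hS _), hind]
    have h1 := tendsto_integral_smul_of_abs_le_poisson hh hxh
      (k := fun t y => t / (t ^ 2 + (x - y) ^ 2)) (fun t => by fun_prop)
      (fun t ht y => (abs_of_pos (by positivity)).le) (fun t ht => integral_poisson ht x)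
    have h2 := tendsto_integral_smul_of_abs_le_poisson hf hxf
      (k := fun t y => (x - y) / (t ^ 2 + (x - y) ^ 2) - truncInv t (x - y))
      (fun t => measurable_conjPoisson_sub_truncInv t x)
      (fun t ht y => abs_conjPoisson_sub_truncInv_le ht (x - y))
      (fun t ht => integral_conjPoisson_sub_truncInv t x)
    -- Poisson integral of `h` minus (conjugate Poisson minus truncated) integral of `f`: the first
    -- two agree, so the truncated integral remains.
    have h3 := h1.sub h2
    rw [zero_smul, sub_zero] at h3
    refine h3.congr' ?_
    filter_upwards [self_mem_nhdsWithin] with t ht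
    have ht' : 0 < t := ht
    simp only [sub_smul]
    rw [integral_sub (integrable_smul_of_abs_le hf (by fun_prop)
      fun y => abs_conjPoisson_le ht' (x - y)) (htr t ht'),
      hfh.integral_poisson_eq hf hh x ht', sub_sub_cancel]

/-! ### Bounded bilinear maps on projective tensor products -/

theorem CompletedProjTensor.exists_extension {𝕜 E G X : Type*} [RCLike 𝕜] [NormedAddCommGroup E]
    [NormedSpace 𝕜 E] [NormedAddCommGroup G] [NormedSpace 𝕜 G] [NormedAddCommGroup X]
    [NormedSpace 𝕜 X] [CompleteSpace X] (B : E →ₗ[𝕜] G →ₗ[𝕜] X) {C : ℝ} (hC : 0 ≤ C)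
    (hB : ∀ x y, ‖B x y‖ ≤ C * (‖x‖ * ‖y‖)) :
    ∃ K : CompletedProjTensor 𝕜 E G →L[𝕜] X, ‖K‖ ≤ C ∧
      ∀ (n : ℕ) (x : Fin n → E) (y : Fin n → G),
        K ((∑ i, ProjTensor.tmul (x i) (y i) : ProjTensor 𝕜 E G) : CompletedProjTensor 𝕜 E G) =
          ∑ i, B (x i) (y i) := by
  let T : ProjTensor 𝕜 E G →ₗ[𝕜] X := TensorProduct.lift B
  have hT : ∀ (n : ℕ) (x : Fin n → E) (y : Fin n → G),
      T (∑ i, ProjTensor.tmul (x i) (y i)) = ∑ i, B (x i) (y i) := fun n x y => by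
    rw [map_sum]
    exact Finset.sum_congr rfl fun i _ => TensorProduct.lift.tmul _ _
  have hTn : ∀ u, ‖T u‖ ≤ C * ‖u‖ := fun u => by
    refine le_of_forall_pos_le_add fun ε hε => ?_
    obtain ⟨_, ⟨n, x, y, hu, rfl⟩, h1⟩ := exists_lt_of_csInf_lt (ProjTensor.reprSums_nonempty u)
      -- The denominator `C + 1` instead of `C` covers the case `C = 0`.
      (lt_add_of_pos_right (sInf (ProjTensor.reprSums u)) (show 0 < ε / (C + 1) by positivity))
    have h2 : ‖T u‖ ≤ C * ∑ i, ‖x i‖ * ‖y i‖ := by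
      rw [hu, hT, Finset.mul_sum]
      exact norm_sum_le_of_le _ fun i _ => hB _ _
    have h3 : C * (ε / (C + 1)) ≤ ε := by
      rw [mul_div_assoc', div_le_iff₀ (by positivity)]
      nlinarith
    have h4 := mul_le_mul_of_nonneg_left h1.le hC
    change ‖T u‖ ≤ C * sInf (ProjTensor.reprSums u) + ε
    linarith [mul_add C (sInf (ProjTensor.reprSums u)) (ε / (C + 1))]
  let e : ProjTensor 𝕜 E G →ₗ[𝕜] CompletedProjTensor 𝕜 E G :=
    (UniformSpace.Completion.toComplL (𝕜 := 𝕜) (E := ProjTensor 𝕜 E G)).toLinearMap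
  have he : DenseRange e := UniformSpace.Completion.denseRange_coe
  have hTe : ∀ u, ‖T u‖ ≤ C * ‖e u‖ := fun u => by
    have : ‖e u‖ = ‖u‖ := UniformSpace.Completion.norm_coe u
    rw [this]
    exact hTn u
  refine ⟨T.extendOfNorm e, LinearMap.opNorm_extendOfNorm_le he hC hTe, fun n x y => ?_⟩
  rw [← hT]
  exact LinearMap.extendOfNorm_eq he ⟨C, hTe⟩ _

/-! ### Principal values and values of `𝐊` -/

section Values

variable {𝕜 : Type*} [RCLike 𝕜]

theorem HasPV.const_mul {φ : ℝ → 𝕜} {c : ℝ} {v : 𝕜} (h : HasPV φ c v) (a : 𝕜) :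
    HasPV (fun y => a * φ y) c (a * v) := by
  refine ⟨fun ε hε => (h.1 ε hε).const_mul a, ?_⟩
  simp only [integral_const_mul]
  exact h.2.const_mul a

theorem HasPV.add {φ ψ : ℝ → 𝕜} {c : ℝ} {v w : 𝕜} (h : HasPV φ c v) (h' : HasPV ψ c w) :
    HasPV (fun y => φ y + ψ y) c (v + w) := by
  refine ⟨fun ε hε => (h.1 ε hε).add (h'.1 ε hε), ?_⟩
  refine (h.2.add h'.2).congr' ?_
  filter_upwards [self_mem_nhdsWithin] with ε hε
  exact (integral_add (h.1 ε hε) (h'.1 ε hε)).symm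

theorem hasPV_zero (c : ℝ) : HasPV (fun _ => (0 : 𝕜)) c 0 :=
  ⟨fun _ _ => integrableOn_zero, by simp⟩

theorem HasKValue.zero (x : ℝ × ℝ) : HasKValue (fun _ => (0 : 𝕜)) x 0 :=
  ⟨fun _ => 0, Eventually.of_forall fun y => by simpa using hasPV_zero (𝕜 := 𝕜) _,
    integrable_zero _ _ _, by simp⟩

/-- The singular point depends on `x` and `y₂` only, not on the function, so the symmetric
truncations match and principal values add. -/
theorem HasKValue.add {f f' : ℝ × ℝ → 𝕜} {x : ℝ × ℝ} {v v' : 𝕜} (h : HasKValue f x v)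
    (h' : HasKValue f' x v') : HasKValue (fun y => f y + f' y) x (v + v') := by
  obtain ⟨G, hG, hGi, rfl⟩ := h
  obtain ⟨G', hG', hGi', rfl⟩ := h'
  refine ⟨fun y => G y + G' y, ?_, hGi.add hGi', by rw [integral_add hGi hGi', mul_add]⟩
  filter_upwards [hG, hG'] with y h h'
  simpa only [add_div] using h.add h'

theorem HasKValue.sum {ι : Type*} (s : Finset ι) {f : ι → ℝ × ℝ → 𝕜} {x : ℝ × ℝ} {v : ι → 𝕜}
    (h : ∀ i ∈ s, HasKValue (f i) x (v i)) :
    HasKValue (fun y => ∑ i ∈ s, f i y) x (∑ i ∈ s, v i) := by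
  classical
  induction s using Finset.induction_on with
  | empty => simpa using HasKValue.zero x
  | insert i s hi ih =>
    simp only [Finset.sum_insert hi]
    exact (h i (Finset.mem_insert_self i s)).add
      (ih fun j hj => h j (Finset.mem_insert_of_mem hj))

/-- The integrand `g(y) h(x₁ y / x₂) / x₂` obtained from `f ⊗ g` by the inner integration in `𝐊`,
where `h` is the Hilbert transform of `f`; it is zero for `x₂ = 0`. -/
noncomputable def kernelSlice (h g : ℝ → 𝕜) (x : ℝ × ℝ) (y : ℝ) : 𝕜 :=
  x.2⁻¹ • (g y * h (x.1 * y / x.2))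

theorem stronglyMeasurable_integral_kernelSlice {h g : ℝ → 𝕜} (hh : StronglyMeasurable h)
    (hg : StronglyMeasurable g) : StronglyMeasurable fun x => ∫ y, kernelSlice h g x y := by
  refine StronglyMeasurable.integral_prod_right (f := kernelSlice h g) ?_
  have h1 : Measurable fun p : (ℝ × ℝ) × ℝ => p.1.2⁻¹ := by fun_prop
  have h2 : Measurable fun p : (ℝ × ℝ) × ℝ => p.1.1 * p.2 / p.1.2 := by fun_prop
  exact h1.stronglyMeasurable.smul
    ((hg.comp_measurable measurable_snd).mul (hh.comp_measurable h2))

theorem ae_comp_mul_div {p : ℝ → Prop} (hp : ∀ᵐ y, p y) {a b : ℝ} (ha : a ≠ 0) (hb : b ≠ 0) :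
    ∀ᵐ y, p (a * y / b) := by
  have hq : Measure.QuasiMeasurePreserving (fun y : ℝ => a * y / b) volume volume := by
    have h1 : (fun y : ℝ => a * y / b) = fun y => (a / b) * y := by
      ext y
      ring
    refine ⟨by fun_prop, ?_⟩
    rw [h1, Real.map_volume_mul_left (div_ne_zero ha hb)]
    exact Measure.smul_absolutelyContinuous
  exact hq.ae hp

/-- For `x₂ ≠ 0` the dilation by `x₁/x₂` pulls null sets back to null sets only because `x₁ ≠ 0`;
for `x₂ = 0` both sides vanish since `0⁻¹ = 0`. -/
theorem kernelSlice_congr {h h' g g' : ℝ → 𝕜} (hh : h =ᵐ[volume] h') (hg : g =ᵐ[volume] g')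
    {x : ℝ × ℝ} (hx : x.1 ≠ 0) : kernelSlice h g x =ᵐ[volume] kernelSlice h' g' x := by
  rcases eq_or_ne x.2 0 with h0 | h0
  · exact Eventually.of_forall fun y => by simp [kernelSlice, h0]
  · filter_upwards [hg, ae_comp_mul_div hh hx h0] with y h1 h2
    simp only [kernelSlice, h1, h2]

theorem ae_norm_le_norm_Lp_top (g : Lp 𝕜 ∞ (volume : Measure ℝ)) : ∀ᵐ y, ‖g y‖ ≤ ‖g‖ := by
  have h1 : eLpNormEssSup g volume ≠ ∞ := by
    have := Lp.eLpNorm_ne_top g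
    rwa [eLpNorm_exponent_top] at this
  filter_upwards [ae_le_eLpNormEssSup (f := g) (μ := (volume : Measure ℝ))] with y hy
  rw [Lp.norm_def, eLpNorm_exponent_top, ← toReal_enorm]
  exact ENNReal.toReal_mono h1 hy

variable (h : Lp 𝕜 1 (volume : Measure ℝ)) (g : Lp 𝕜 ∞ (volume : Measure ℝ))

theorem integrable_comp_mul_div {x : ℝ × ℝ} (hx : x.1 ≠ 0) (h0 : x.2 ≠ 0) :
    Integrable fun y => h (x.1 * y / x.2) := by
  have := (L1.integrable_coeFn h).comp_mul_left' (div_ne_zero hx h0)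
  refine this.congr (Eventually.of_forall fun y => ?_)
  simp only [div_mul_eq_mul_div]

theorem integrable_kernelSlice {x : ℝ × ℝ} (hx : x.1 ≠ 0) : Integrable (kernelSlice h g x) := by
  rcases eq_or_ne x.2 0 with h0 | h0
  · refine (integrable_zero ℝ 𝕜 volume).congr (Eventually.of_forall fun y => ?_)
    simp [kernelSlice, h0]
  · exact ((integrable_comp_mul_div h hx h0).bdd_mul (Lp.aestronglyMeasurable g)
      (ae_norm_le_norm_Lp_top g)).smul x.2⁻¹

theorem norm_integral_kernelSlice_le {x : ℝ × ℝ} (hx : x.1 ≠ 0) :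
    ‖∫ y, kernelSlice h g x y‖ ≤ ‖h‖ * ‖g‖ * |x.1|⁻¹ := by
  rcases eq_or_ne x.2 0 with h0 | h0
  · have h1 : ∀ y, kernelSlice h g x y = 0 := fun y => by simp [kernelSlice, h0]
    simp only [h1, integral_zero, norm_zero]
    positivity
  · calc ‖∫ y, kernelSlice h g x y‖ ≤ ∫ y, |x.2|⁻¹ * ‖g‖ * ‖h (x.1 / x.2 * y)‖ := by
          refine norm_integral_le_of_norm_le ?_ ?_
          · exact ((L1.integrable_coeFn h).comp_mul_left' (div_ne_zero hx h0)).norm.const_mul _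
          · filter_upwards [ae_norm_le_norm_Lp_top g] with y hy
            rw [kernelSlice, norm_smul, norm_mul, norm_inv, Real.norm_eq_abs, mul_assoc,
              div_mul_eq_mul_div]
            gcongr
      _ = _ := by
          rw [integral_const_mul, Measure.integral_comp_mul_left (fun u => ‖h u‖),
            L1.norm_eq_integral_norm, smul_eq_mul, inv_div, abs_div]
          have := abs_pos.2 h0
          field_simp

theorem hasKValue_mul (f : HardyOne 𝕜) {x : ℝ × ℝ} (hx : x.1 ≠ 0) :
    HasKValue (fun y => HardyOne.fn f y.1 * g y.2) x
      (∫ y, kernelSlice (HardyOne.hilbert f) g x y) := by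
  have hf := L1.integrable_coeFn (HardyOne.fn f)
  have hh := L1.integrable_coeFn (HardyOne.hilbert f)
  have hfh : IsHilbertTransform (HardyOne.fn f) (HardyOne.hilbert f) := f.2
  refine ⟨fun y => Real.pi • kernelSlice (HardyOne.hilbert f) g x y, ?_,
    (integrable_kernelSlice _ g hx).smul Real.pi, ?_⟩
  · rcases eq_or_ne x.2 0 with h0 | h0
    -- Here the denominator `x₁y₂` does not involve `y₁`, so the inner integral is a multiple of `∫
    -- f = 0`, in agreement with the zero convention of `kernelSlice`.
    · refine Eventually.of_forall fun y => ?_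
      have h1 := hf.hasPV (x.1 * y / x.2)
      rw [hfh.integral_eq_zero hf hh] at h1
      convert h1.const_mul (g y / ((x.1 * y : ℝ) : 𝕜)) using 1
      · ext y₁
        rw [h0, zero_mul, sub_zero]
        ring
      · simp [kernelSlice, h0]
    · filter_upwards [ae_comp_mul_div (hfh.ae_hasPV hf hh) hx h0] with y hy
      convert hy.const_mul (g y / (x.2 : 𝕜)) using 1
      · ext y₁
        have h1 : x.1 * y - x.2 * y₁ = x.2 * (x.1 * y / x.2 - y₁) := by
          field_simp
        rw [h1, RCLike.ofReal_mul, div_mul_div_comm, mul_comm (g y)]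
      · simp only [kernelSlice, RCLike.real_smul_eq_coe_mul, RCLike.ofReal_inv]
        ring
  · rw [integral_smul, RCLike.real_smul_eq_coe_mul, ← mul_assoc, ← RCLike.ofReal_mul,
      inv_mul_cancel₀ Real.pi_ne_zero, RCLike.ofReal_one, one_mul]

end Values

/-! ### The bilinear map induced by `𝐊` -/

section Bilinear

variable {𝕜 : Type*} [RCLike 𝕜] {μ : Measure (ℝ × ℝ)}

/-- The class in `L⁰(μ)` of the function `𝐊 (f ⊗ g)`. -/
noncomputable def kernelClass (μ : Measure (ℝ × ℝ)) (f : HardyOne 𝕜)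
    (g : Lp 𝕜 ∞ (volume : Measure ℝ)) : (ℝ × ℝ) →ₘ[μ] 𝕜 :=
  AEEqFun.mk (fun x => ∫ y, kernelSlice (HardyOne.hilbert f) g x y)
    (stronglyMeasurable_integral_kernelSlice (Lp.stronglyMeasurable _)
      (Lp.stronglyMeasurable _)).aestronglyMeasurable

theorem coeFn_kernelClass (f : HardyOne 𝕜) (g : Lp 𝕜 ∞ (volume : Measure ℝ)) :
    kernelClass μ f g =ᵐ[μ] fun x => ∫ y, kernelSlice (HardyOne.hilbert f) g x y :=
  AEEqFun.coeFn_mk _ _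

theorem kernelClass_add_left (hμ : ∀ᵐ x ∂μ, x.1 ≠ 0) (f f' : HardyOne 𝕜)
    (g : Lp 𝕜 ∞ (volume : Measure ℝ)) :
    kernelClass μ (f + f') g = kernelClass μ f g + kernelClass μ f' g := by
  refine AEEqFun.ext ?_
  filter_upwards [hμ, coeFn_kernelClass (μ := μ) (f + f') g, coeFn_kernelClass (μ := μ) f g,
    coeFn_kernelClass (μ := μ) f' g, AEEqFun.coeFn_add (kernelClass μ f g) (kernelClass μ f' g)]
    with x hx h1 h2 h3 h4
  rw [h1, h4, Pi.add_apply, h2, h3, ← integral_add (integrable_kernelSlice _ g hx)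
    (integrable_kernelSlice _ g hx)]
  refine integral_congr_ae ((kernelSlice_congr
    (Lp.coeFn_add (HardyOne.hilbert f) (HardyOne.hilbert f')) (ae_eq_refl _) hx).trans ?_)
  exact Eventually.of_forall fun y => by
    simp only [kernelSlice, Pi.add_apply, mul_add, smul_add]

theorem kernelClass_add_right (hμ : ∀ᵐ x ∂μ, x.1 ≠ 0) (f : HardyOne 𝕜)
    (g g' : Lp 𝕜 ∞ (volume : Measure ℝ)) :
    kernelClass μ f (g + g') = kernelClass μ f g + kernelClass μ f g' := by
  refine AEEqFun.ext ?_
  filter_upwards [hμ, coeFn_kernelClass (μ := μ) f (g + g'), coeFn_kernelClass (μ := μ) f g,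
    coeFn_kernelClass (μ := μ) f g', AEEqFun.coeFn_add (kernelClass μ f g) (kernelClass μ f g')]
    with x hx h1 h2 h3 h4
  rw [h1, h4, Pi.add_apply, h2, h3, ← integral_add (integrable_kernelSlice _ g hx)
    (integrable_kernelSlice _ g' hx)]
  refine integral_congr_ae ((kernelSlice_congr (ae_eq_refl _) (Lp.coeFn_add g g') hx).trans ?_)
  exact Eventually.of_forall fun y => by
    simp only [kernelSlice, Pi.add_apply, add_mul, smul_add]

theorem kernelClass_smul_left (hμ : ∀ᵐ x ∂μ, x.1 ≠ 0) (c : 𝕜) (f : HardyOne 𝕜)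
    (g : Lp 𝕜 ∞ (volume : Measure ℝ)) :
    kernelClass μ (c • f) g = c • kernelClass μ f g := by
  refine AEEqFun.ext ?_
  filter_upwards [hμ, coeFn_kernelClass (μ := μ) (c • f) g, coeFn_kernelClass (μ := μ) f g,
    AEEqFun.coeFn_smul c (kernelClass μ f g)] with x hx h1 h2 h3
  rw [h1, h3, Pi.smul_apply, h2, ← integral_smul]
  refine integral_congr_ae ((kernelSlice_congr
    (Lp.coeFn_smul c (HardyOne.hilbert f)) (ae_eq_refl _) hx).trans ?_)
  exact Eventually.of_forall fun y => by
    simp only [kernelSlice, Pi.smul_apply, mul_smul_comm, smul_comm c]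

theorem kernelClass_smul_right (hμ : ∀ᵐ x ∂μ, x.1 ≠ 0) (c : 𝕜) (f : HardyOne 𝕜)
    (g : Lp 𝕜 ∞ (volume : Measure ℝ)) :
    kernelClass μ f (c • g) = c • kernelClass μ f g := by
  refine AEEqFun.ext ?_
  filter_upwards [hμ, coeFn_kernelClass (μ := μ) f (c • g), coeFn_kernelClass (μ := μ) f g,
    AEEqFun.coeFn_smul c (kernelClass μ f g)] with x hx h1 h2 h3
  rw [h1, h3, Pi.smul_apply, h2, ← integral_smul]
  refine integral_congr_ae ((kernelSlice_congr (ae_eq_refl _) (Lp.coeFn_smul c g) hx).trans ?_)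
  exact Eventually.of_forall fun y => by
    simp only [kernelSlice, Pi.smul_apply, smul_mul_assoc, smul_comm c]

theorem kernelClass_mem (hμ : ∀ᵐ x ∂μ, x.1 ≠ 0) (F : BanachFunctionLattice 𝕜 μ) (w₁ : F.carrier)
    (hw₁ : ∀ᵐ x ∂μ, (w₁ : (ℝ × ℝ) →ₘ[μ] 𝕜) x = ((|x.1|⁻¹ : ℝ) : 𝕜)) (f : HardyOne 𝕜)
    (g : Lp 𝕜 ∞ (volume : Measure ℝ)) :
    ∃ hm : kernelClass μ f g ∈ F.carrier,
      ‖(⟨kernelClass μ f g, hm⟩ : F.carrier)‖ ≤ ‖w₁‖ * (‖f‖ * ‖g‖) := by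
  set c : 𝕜 := ((‖HardyOne.hilbert f‖ * ‖g‖ : ℝ) : 𝕜) with hc
  have hcn : ‖c‖ = ‖HardyOne.hilbert f‖ * ‖g‖ := by
    rw [hc, RCLike.norm_ofReal, abs_of_nonneg (by positivity)]
  -- The majorant is `w₁` scaled by `‖Hf‖₁ ‖g‖_∞`; only the part `‖Hf‖₁` of the Hardy norm is
  -- needed.
  obtain ⟨hm, hn⟩ := F.solid (kernelClass μ f g) (c • w₁) (by
    filter_upwards [hμ, hw₁, coeFn_kernelClass (μ := μ) f g,
      AEEqFun.coeFn_smul c (w₁ : (ℝ × ℝ) →ₘ[μ] 𝕜)] with x hx h1 h2 h3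
    rw [Submodule.coe_smul, h2, h3, Pi.smul_apply, h1, norm_smul, hcn, RCLike.norm_ofReal,
      abs_of_nonneg (by positivity : 0 ≤ |x.1|⁻¹)]
    exact norm_integral_kernelSlice_le _ g hx)
  refine ⟨hm, hn.trans ?_⟩
  change ‖c • w₁‖ ≤ _
  rw [norm_smul, hcn, mul_comm, HardyOne.norm_eq]
  gcongr
  exact le_add_of_nonneg_left (norm_nonneg _)

theorem BanachFunctionLattice.coeFn_sum {α ι : Type*} [MeasurableSpace α] {ν : Measure α}
    (F : BanachFunctionLattice 𝕜 ν) (s : Finset ι) (u : ι → F.carrier) :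
    ((∑ i ∈ s, u i : F.carrier) : α →ₘ[ν] 𝕜) =ᵐ[ν]
      fun x => ∑ i ∈ s, (u i : α →ₘ[ν] 𝕜) x := by
  classical
  induction s using Finset.induction_on with
  | empty =>
    simp only [Finset.sum_empty]
    exact AEEqFun.coeFn_zero
  | insert i s hi ih =>
    simp only [Finset.sum_insert hi]
    filter_upwards [ih, AEEqFun.coeFn_add (u i : α →ₘ[ν] 𝕜)
      ((∑ i ∈ s, u i : F.carrier) : α →ₘ[ν] 𝕜)] with x h1 h2
    rw [Submodule.coe_add, h2, Pi.add_apply, h1]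

end Bilinear

theorem mainTheorem9 {𝕜 : Type*} [RCLike 𝕜] (μ : Measure (ℝ × ℝ))
    (hμ : μ {x : ℝ × ℝ | x.1 = 0} = 0)
    (F : BanachFunctionLattice 𝕜 μ) (w₁ : F.carrier)
    (hw₁ : ∀ᵐ x ∂μ, (w₁ : (ℝ × ℝ) →ₘ[μ] 𝕜) x = ((|x.1|⁻¹ : ℝ) : 𝕜)) :
    ∃ K : CompletedProjTensor 𝕜 (HardyOne 𝕜) (Lp 𝕜 ∞ (volume : Measure ℝ)) →L[𝕜] F.carrier,
      ‖K‖ ≤ ‖w₁‖ ∧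
      ∀ (n : ℕ) (f : Fin n → HardyOne 𝕜) (g : Fin n → Lp 𝕜 ∞ (volume : Measure ℝ)),
        ∀ᵐ x ∂μ, HasKValue (fun y => ∑ i, HardyOne.fn (f i) y.1 * g i y.2) x
          ((K ((∑ i, ProjTensor.tmul (f i) (g i) : ProjTensor 𝕜 (HardyOne 𝕜)
            (Lp 𝕜 ∞ (volume : Measure ℝ))) :
            CompletedProjTensor 𝕜 (HardyOne 𝕜) (Lp 𝕜 ∞ (volume : Measure ℝ))) :
            (ℝ × ℝ) →ₘ[μ] 𝕜) x) := by
  have hμ' : ∀ᵐ x ∂μ, x.1 ≠ 0 := by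
    rw [ae_iff]
    simpa using hμ
  choose hm hn using kernelClass_mem hμ' F w₁ hw₁
  let B : HardyOne 𝕜 →ₗ[𝕜] Lp 𝕜 ∞ (volume : Measure ℝ) →ₗ[𝕜] F.carrier :=
    LinearMap.mk₂ 𝕜 (fun f g => ⟨kernelClass μ f g, hm f g⟩)
      (fun f f' g => Subtype.ext (kernelClass_add_left hμ' f f' g))
      (fun c f g => Subtype.ext (kernelClass_smul_left hμ' c f g))
      (fun f g g' => Subtype.ext (kernelClass_add_right hμ' f g g'))
      (fun c f g => Subtype.ext (kernelClass_smul_right hμ' c f g))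
  obtain ⟨K, hK, hKt⟩ := CompletedProjTensor.exists_extension B (norm_nonneg w₁) hn
  refine ⟨K, hK, fun n f g => ?_⟩
  rw [hKt]
  -- The exceptional null set may depend on the chosen representation; off it the image is the
  -- finite sum of the kernel integrals, each a value of `𝐊`.
  filter_upwards [hμ', F.coeFn_sum Finset.univ fun i => B (f i) (g i),
    ae_all_iff.2 fun i => coeFn_kernelClass (μ := μ) (f i) (g i)] with x hx h1 h2
  rw [h1]
  refine HasKValue.sum _ fun i _ => ?_
  have h3 : ((B (f i) (g i) : F.carrier) : (ℝ × ℝ) →ₘ[μ] 𝕜) x =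
      ∫ y, kernelSlice (HardyOne.hilbert (f i)) (g i) x y := h2 i
  rw [h3]
  exact hasKValue_mul (g i) (f i) hx
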